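/- Let $n\in\mathbb N$, let $\mathbb C^+=\{w\in\mathbb C:\operatorname{Im}w>0\}$, and let $\mathscr S_n(\mathbb C^+)$ be the set of analytic functions $B:\mathbb C^+\to\mathbb C^{n\times n}$ with $\|B(w)\|\le 1$ (Euclidean operator norm) for all $w$. If $B\in\mathscr S_n(\mathbb C^+)$ and $\alpha$ is a unitary $n\times n$ matrix such that $I-B(w)\alpha^*$ is invertible for all $w\in\mathbb C^+$, the Clark measure $\mu^{B\alpha^*}$ is the unique finite nonnegative matrix-valued Borel measure on $\mathbb R$ for which there is a positive semidefinite matrix $c$ with $$\operatorname{Re}\big[(I-B(w)\alpha^*)^{-1}(I+B(w)\alpha^*)\big]=c\,\operatorname{Im}w+\int_{\mathbb R}\frac{(1+t^2)\operatorname{Im}w}{|t-w|^2}\,\mu^{B\alpha^*}(dt),\qquad w\in\mathbb C^+,$$ where $\operatorname{Re}A=\tfrac12(A+A^*)$. Let $\frac{d\mu^{B\alpha^*}}{dm}$ denote the Lebesgue weight of its absolutely continuous part, i.e. its entrywise Radon–Nikodym derivative with respect to Lebesgue measure $m$ on $\mathbb R$. **Theorem.** Let $B_1,B_2\in\mathscr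 S_n(\mathbb C^+)$ and let $R,Q$ be constant unitary $n\times n$ matrices with $B_1(w)=R\,B_2(w)\,Q$ for all $w\in\mathbb C^+$. Let $\alpha$ be a unitary $n\times n$ matrix such that $I-B_1(w)\alpha^*$ is invertible for all $w\in\mathbb C^+$ (equivalently, $I-B_2(w)Q\alpha^*R$ is). Then $$\frac{d\mu^{B_1\alpha^*}}{dm}(s)=R\,\frac{d\mu^{B_2(Q\alpha^*R)}}{dm}(s)\,R^*\qquad\text{for Lebesgue-a.e. }s\in\mathbb R.$$ -/

import Mathlib

open MeasureTheory
open scoped Matrix ComplexOrder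

noncomputable section

/-- The closed unit ball `[H^∞(X) ⊗ ℂ^{n×n}]₁` of contractive analytic `n × n` matrix-valued
functions on `X`; functions on `X` are represented by their extensions to `ℂ`, whose values
outside `X` are irrelevant. The norm of a matrix is its operator norm on Euclidean `ℂⁿ`. -/
def schurClass (n : ℕ) (X : Set ℂ) : Set (ℂ → Matrix (Fin n) (Fin n) ℂ) :=
  {B | (∀ i j, DifferentiableOn ℂ (fun w => B w i j) X) ∧
    ∀ w ∈ X, ‖Matrix.toEuclideanCLM (𝕜 := ℂ) (B w)‖ ≤ 1}

/-- The open upper half-plane. -/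
def upperHalf : Set ℂ := {w | 0 < w.im}

/-- The Herglotz function `(I - C(w))⁻¹ (I + C(w))` of a matrix-valued function `C`. -/
def herglotz {n : ℕ} (C : ℂ → Matrix (Fin n) (Fin n) ℂ) (w : ℂ) : Matrix (Fin n) (Fin n) ℂ :=
  (1 - C w)⁻¹ * (1 + C w)

/-- The real part `(A + A*) / 2` of a matrix. -/
def hermitianPart {n : ℕ} (A : Matrix (Fin n) (Fin n) ℂ) : Matrix (Fin n) (Fin n) ℂ :=
  (2 : ℂ)⁻¹ • (A + Aᴴ)

/-- The `(j, k)` entry of a matrix-valued measure on the line, as a complex measure. -/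
def measureEntry {n : ℕ} (μ : VectorMeasure ℝ (Matrix (Fin n) (Fin n) ℂ)) (j k : Fin n) :
    ComplexMeasure ℝ :=
  μ.mapRange (Matrix.entryAddMonoidHom ℂ j k) (continuous_id.matrix_elem j k)

/-- The Poisson kernel of the disk transported to the upper half-plane by the Cayley transform
`γ(w) = (w - i) / (w + i)`: `(1 - |γ(w)|²) / |1 - γ(w) conj(γ(t))|² = Im w (1 + t²) / |t - w|²`. -/
def cayleyPoissonKernel (w : ℂ) (t : ℝ) : ℝ :=
  w.im * (1 + t ^ 2) / ‖(t : ℂ) - w‖ ^ 2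

/-- `μ` is the nonnegative matrix-valued measure on `ℝ` in the Herglotz representation
`Re H(w) = c Im w + ∫ Im w (1 + t²) / |t - w|² μ(dt)` on the upper half-plane, where
`H = (I - C)⁻¹ (I + C)`. In terms of the disk, `μ` is the pullback under the Cayley transform of
the Clark measure of `C ∘ γ⁻¹` on the circle, and `c` is the mass of the latter at `γ(∞) = 1`. -/
def IsClarkMeasure {n : ℕ} (C : ℂ → Matrix (Fin n) (Fin n) ℂ)
    (μ : VectorMeasure ℝ (Matrix (Fin n) (Fin n) ℂ)) : Prop :=
  (∀ E : Set ℝ, MeasurableSet E → (μ E).PosSemidef) ∧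
  ∃ c : Matrix (Fin n) (Fin n) ℂ, c.PosSemidef ∧
    ∀ w ∈ upperHalf, ∀ j k : Fin n,
      hermitianPart (herglotz C w) j k =
        (w.im : ℂ) * c j k +
          (measureEntry μ j k).integral (cayleyPoissonKernel w) (ContinuousLinearMap.lsmul ℝ ℝ)

open scoped Classical in
/-- The Clark measure of a contractive analytic `C` on the upper half-plane with `I - C(w)`
invertible: the unique measure with `IsClarkMeasure C`. -/
def clarkMeasure {n : ℕ} (C : ℂ → Matrix (Fin n) (Fin n) ℂ) :
    VectorMeasure ℝ (Matrix (Fin n) (Fin n) ℂ) :=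
  if h : ∃ μ, IsClarkMeasure C μ then h.choose else 0

/-- The Lebesgue weight `dμ/dm` of the absolutely continuous part of a matrix-valued measure `μ`:
the matrix of Radon-Nikodym derivatives of its entries with respect to Lebesgue measure. -/
def lebesgueWeight {n : ℕ} (μ : VectorMeasure ℝ (Matrix (Fin n) (Fin n) ℂ)) (s : ℝ) :
    Matrix (Fin n) (Fin n) ℂ :=
  Matrix.of fun j k => (measureEntry μ j k).rnDeriv volume s

end

open Filter Topology

/-! Since `R * Rᴴ = 1`, the function `B₁ αᴴ` equals `R (B₂ Q αᴴ R) Rᴴ`, a unitary conjugate.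
Conjugation passes through the Herglotz transform and its Hermitian part, so if `μ` represents the
inner function then `R μ Rᴴ` represents the outer one (`IsClarkMeasure.conj`). Its weight is `R
(dμ/dm) Rᴴ` almost everywhere because Radon-Nikodym derivatives are linear.

As `clarkMeasure` is a choice, the analytic content is uniqueness (`IsClarkMeasure.unique`). Real
and imaginary parts and Jordan decompositions reduce it to finite positive measures, which are
recovered from their Poisson integrals by integrating against a test function at height `y` and
letting `y → 0`; the term linear in `Im w` disappears. Existence is never needed. -/

/-! ### Bounds on the Poisson kernel. -/

theorem cayleyPoissonKernel_eq (x y t : ℝ) :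
    cayleyPoissonKernel ⟨x, y⟩ t = (1 + t ^ 2) * (y / ((x - t) ^ 2 + y ^ 2)) := by
  have : ‖(t : ℂ) - ⟨x, y⟩‖ ^ 2 = (x - t) ^ 2 + y ^ 2 := by
    rw [Complex.sq_norm, Complex.normSq_apply]
    simp
    ring
  rw [cayleyPoissonKernel, this]
  simp only
  ring

theorem cayleyPoissonKernel_nonneg {y : ℝ} (hy : 0 < y) (x t : ℝ) :
    0 ≤ cayleyPoissonKernel ⟨x, y⟩ t := by
  rw [cayleyPoissonKernel_eq]; positivity

/-- The weight `1 + t ^ 2` is split between `x ^ 2` and `(x - t) ^ 2`; the denominator absorbs the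
latter, so no growth in `t` remains. -/
theorem cayleyPoissonKernel_le {y : ℝ} (hy : 0 < y) (x t : ℝ) :
    cayleyPoissonKernel ⟨x, y⟩ t ≤ (1 + 2 * x ^ 2) * (y / ((x - t) ^ 2 + y ^ 2)) + 2 * y := by
  have h1 : 1 + t ^ 2 ≤ (1 + 2 * x ^ 2) + 2 * (x - t) ^ 2 := by nlinarith [sq_nonneg (2 * x - t)]
  have hD : 0 < (x - t) ^ 2 + y ^ 2 := by positivity
  have h2 : (x - t) ^ 2 * (y / ((x - t) ^ 2 + y ^ 2)) ≤ y := by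
    rw [mul_div_assoc', div_le_iff₀ hD]
    nlinarith [mul_pos hy (sq_pos_of_pos hy)]
  have h3 : 0 ≤ y / ((x - t) ^ 2 + y ^ 2) := by positivity
  rw [cayleyPoissonKernel_eq]
  nlinarith [mul_le_mul_of_nonneg_right h1 h3]

theorem div_sub_sq_add_sq_le_inv {y : ℝ} (hy : 0 < y) (x t : ℝ) :
    y / ((x - t) ^ 2 + y ^ 2) ≤ y⁻¹ := by
  rw [div_le_iff₀ (by positivity), mul_add, sq y, ← mul_assoc, inv_mul_cancel₀ hy.ne', one_mul]
  have : 0 ≤ y⁻¹ * (x - t) ^ 2 := by positivity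
  linarith

theorem continuous_cayleyPoissonKernel {w : ℂ} (hw : w ∈ upperHalf) :
    Continuous (cayleyPoissonKernel w) := by
  unfold cayleyPoissonKernel
  refine Continuous.div (by fun_prop) (by fun_prop) fun t h => ?_
  have : (t : ℂ) - w = 0 := by simpa using h
  have h2 := congrArg Complex.im this
  simp at h2
  exact (ne_of_gt hw) h2

theorem norm_cayleyPoissonKernel_le {w : ℂ} (hw : w ∈ upperHalf) :
    ∃ C, ∀ t, ‖cayleyPoissonKernel w t‖ ≤ C := by
  refine ⟨(1 + 2 * w.re ^ 2) * w.im⁻¹ + 2 * w.im, fun t => ?_⟩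
  have hw' : 0 < w.im := hw
  have h : w = ⟨w.re, w.im⟩ := rfl
  rw [h, Real.norm_of_nonneg (cayleyPoissonKernel_nonneg hw' _ _)]
  refine (cayleyPoissonKernel_le hw' _ _).trans ?_
  have := div_sub_sq_add_sq_le_inv hw' w.re t
  simp only
  gcongr

theorem integrable_cayleyPoissonKernel (p : Measure ℝ) [IsFiniteMeasure p] {w : ℂ}
    (hw : w ∈ upperHalf) : Integrable (cayleyPoissonKernel w) p := by
  obtain ⟨C, hC⟩ := norm_cayleyPoissonKernel_le hw
  exact Integrable.of_bound (continuous_cayleyPoissonKernel hw).aestronglyMeasurable C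
    (.of_forall hC)

/-! ### Boundary limits of Poisson integrals. -/

/-- The substitution `x = t + y * s` replaces the concentrating kernel by a fixed integrable
density, ready for dominated convergence. -/
theorem integral_mul_poisson_eq (f : ℝ → ℝ) {y : ℝ} (hy : 0 < y) (t : ℝ) :
    ∫ x, f x * (y / ((x - t) ^ 2 + y ^ 2)) = ∫ s, f (t + y * s) * (1 + s ^ 2)⁻¹ := by
  rw [← integral_add_left_eq_self _ t]
  have h := Measure.integral_comp_mul_left
    (fun x => f (t + x) * (y / ((t + x - t) ^ 2 + y ^ 2))) y
  rw [abs_of_pos (by positivity), smul_eq_mul, eq_inv_mul_iff_mul_eq₀ hy.ne',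
    ← integral_const_mul] at h
  rw [← h]
  congr with s
  rw [add_sub_cancel_left]
  field_simp
  ring

theorem tendsto_integral_mul_poisson {f : ℝ → ℝ} (hf : Continuous f) {A : ℝ}
    (hA : ∀ x, ‖f x‖ ≤ A) (t : ℝ) :
    Tendsto (fun y => ∫ x, f x * (y / ((x - t) ^ 2 + y ^ 2))) (𝓝[>] 0) (𝓝 (f t * Real.pi)) := by
  have h : Tendsto (fun y => ∫ s, f (t + y * s) * (1 + s ^ 2)⁻¹) (𝓝[>] 0)
      (𝓝 (∫ s, f t * (1 + s ^ 2)⁻¹)) := by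
    refine tendsto_integral_filter_of_dominated_convergence (fun s => A * (1 + s ^ 2)⁻¹)
      (.of_forall fun y => ?_) (.of_forall fun y => .of_forall fun s => ?_)
      (integrable_inv_one_add_sq.const_mul A) (.of_forall fun s => ?_)
    · refine (Continuous.mul (by fun_prop) ?_).aestronglyMeasurable
      exact Continuous.inv₀ (by fun_prop) fun s => by positivity
    · rw [norm_mul, Real.norm_of_nonneg (by positivity : 0 ≤ (1 + s ^ 2)⁻¹)]
      exact mul_le_mul_of_nonneg_right (hA _) (by positivity)
    · refine Tendsto.mul_const _ (tendsto_nhdsWithin_of_tendsto_nhds ?_)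
      have : Continuous fun y => f (t + y * s) := by fun_prop
      simpa using this.tendsto 0
  rw [integral_const_mul, integral_univ_inv_one_add_sq] at h
  refine h.congr' ?_
  filter_upwards [self_mem_nhdsWithin] with y hy
  exact (integral_mul_poisson_eq f hy t).symm

theorem norm_integral_mul_poisson_le {f : ℝ → ℝ} {A : ℝ}
    (hA : ∀ x, ‖f x‖ ≤ A) {y : ℝ} (hy : 0 < y) (t : ℝ) :
    ‖∫ x, f x * (y / ((x - t) ^ 2 + y ^ 2))‖ ≤ A * Real.pi := by
  rw [integral_mul_poisson_eq f hy, ← integral_univ_inv_one_add_sq, ← integral_const_mul]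
  refine norm_integral_le_of_norm_le (integrable_inv_one_add_sq.const_mul A) (.of_forall fun s => ?_)
  rw [norm_mul, Real.norm_of_nonneg (by positivity : 0 ≤ (1 + s ^ 2)⁻¹)]
  exact mul_le_mul_of_nonneg_right (hA _) (by positivity)

theorem integrable_mul_cayleyPoissonKernel_prod {f : ℝ → ℝ} (hf : Continuous f)
    (hfc : HasCompactSupport f) (p : Measure ℝ) [IsFiniteMeasure p] {y : ℝ} (hy : 0 < y) :
    Integrable (Function.uncurry fun x t => f x * cayleyPoissonKernel ⟨x, y⟩ t)
      (volume.prod p) := by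
  have hb : Integrable (fun x => ‖f x‖ * ((1 + 2 * x ^ 2) * y⁻¹ + 2 * y)) :=
    Continuous.integrable_of_hasCompactSupport (by fun_prop) (hfc.norm.mul_right)
  refine (hb.mul_prod (integrable_const (μ := p) (1 : ℝ))).mono' ?_ (.of_forall fun z => ?_)
  · refine Continuous.aestronglyMeasurable ?_
    simp only [Function.uncurry_def, cayleyPoissonKernel_eq]
    refine Continuous.mul (by fun_prop) (Continuous.mul (by fun_prop) ?_)
    exact Continuous.div (by fun_prop) (by fun_prop) fun z => by positivity
  · simp only [Function.uncurry, norm_mul, mul_one]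
    rw [Real.norm_of_nonneg (cayleyPoissonKernel_nonneg hy _ _)]
    gcongr
    refine (cayleyPoissonKernel_le hy _ _).trans ?_
    gcongr
    exact div_sub_sq_add_sq_le_inv hy _ _

theorem integral_mul_cayleyPoissonKernel (f : ℝ → ℝ) (y t : ℝ) :
    ∫ x, f x * cayleyPoissonKernel ⟨x, y⟩ t =
      (1 + t ^ 2) * ∫ x, f x * (y / ((x - t) ^ 2 + y ^ 2)) := by
  rw [← integral_const_mul]
  congr with x
  rw [cayleyPoissonKernel_eq]
  ring

/-- Uniformity in `y` and `t` supplies the constant dominating function for a finite measure in `t`.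
Compact support keeps `f x * (1 + 2 * x ^ 2)` bounded. -/
theorem norm_integral_mul_cayleyPoissonKernel_le {f : ℝ → ℝ} (hf : Continuous f)
    (hfc : HasCompactSupport f) :
    ∃ C, ∀ y ∈ Set.Ioc (0 : ℝ) 1, ∀ t, ‖∫ x, f x * cayleyPoissonKernel ⟨x, y⟩ t‖ ≤ C := by
  obtain ⟨A, hA⟩ := (hfc.mul_right (f' := fun x => 1 + 2 * x ^ 2)).exists_bound_of_continuous
    (by fun_prop)
  have hfi : Integrable f := hf.integrable_of_hasCompactSupport hfc
  refine ⟨A * Real.pi + 2 * ∫ x, ‖f x‖, fun y ⟨hy, hy1⟩ t => ?_⟩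
  have hA' : ∀ x, ‖‖f x‖ * (1 + 2 * x ^ 2)‖ ≤ A := fun x => by simpa using hA x
  have hP : Integrable fun x => ‖f x‖ * (1 + 2 * x ^ 2) * (y / ((x - t) ^ 2 + y ^ 2)) := by
    refine Continuous.integrable_of_hasCompactSupport (Continuous.mul (by fun_prop) ?_)
      hfc.norm.mul_right.mul_right
    exact Continuous.div (by fun_prop) (by fun_prop) fun z => by positivity
  calc ‖∫ x, f x * cayleyPoissonKernel ⟨x, y⟩ t‖
      ≤ ∫ x, (‖f x‖ * (1 + 2 * x ^ 2) * (y / ((x - t) ^ 2 + y ^ 2)) + 2 * y * ‖f x‖) := by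
        refine norm_integral_le_of_norm_le (hP.add (hfi.norm.const_mul _)) (.of_forall fun x => ?_)
        rw [norm_mul, Real.norm_of_nonneg (cayleyPoissonKernel_nonneg hy _ _)]
        have := mul_le_mul_of_nonneg_left (cayleyPoissonKernel_le hy x t) (norm_nonneg (f x))
        linarith
    _ = (∫ x, ‖f x‖ * (1 + 2 * x ^ 2) * (y / ((x - t) ^ 2 + y ^ 2))) + 2 * y * ∫ x, ‖f x‖ := by
        rw [integral_add hP (hfi.norm.const_mul _), integral_const_mul]
    _ ≤ A * Real.pi + 2 * ∫ x, ‖f x‖ := by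
        have h0 : 0 ≤ ∫ x, ‖f x‖ := integral_nonneg fun x => norm_nonneg (f x)
        refine add_le_add ((le_abs_self _).trans (norm_integral_mul_poisson_le hA' hy t)) ?_
        gcongr
        linarith

theorem tendsto_integral_mul_integral_cayleyPoissonKernel {f : ℝ → ℝ} (hf : Continuous f)
    (hfc : HasCompactSupport f) (p : Measure ℝ) [IsFiniteMeasure p] :
    Tendsto (fun y => ∫ x, f x * ∫ t, cayleyPoissonKernel ⟨x, y⟩ t ∂p) (𝓝[>] 0)
      (𝓝 (∫ t, (1 + t ^ 2) * (f t * Real.pi) ∂p)) := by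
  obtain ⟨C, hC⟩ := norm_integral_mul_cayleyPoissonKernel_le hf hfc
  obtain ⟨A, hA⟩ := hfc.exists_bound_of_continuous hf
  have hpos : ∀ᶠ y : ℝ in 𝓝[>] 0, y ∈ Set.Ioc (0 : ℝ) 1 := Ioc_mem_nhdsGT one_pos
  have h : Tendsto (fun y => ∫ t, (∫ x, f x * cayleyPoissonKernel ⟨x, y⟩ t) ∂p) (𝓝[>] 0)
      (𝓝 (∫ t, (1 + t ^ 2) * (f t * Real.pi) ∂p)) := by
    refine tendsto_integral_filter_of_dominated_convergence (fun _ => C) ?_ ?_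
      (integrable_const C) (.of_forall fun t => ?_)
    · filter_upwards [hpos] with y hy
      have hi := (integrable_mul_cayleyPoissonKernel_prod hf hfc p hy.1).swap
      exact hi.aestronglyMeasurable.integral_prod_right'
    · filter_upwards [hpos] with y hy
      exact .of_forall (hC y hy)
    · simp only [integral_mul_cayleyPoissonKernel]
      exact (tendsto_integral_mul_poisson hf hA t).const_mul _
  refine h.congr' ?_
  filter_upwards [hpos] with y hy
  rw [← integral_integral_swap (integrable_mul_cayleyPoissonKernel_prod hf hfc p hy.1)]
  simp only [integral_const_mul]

/-- A finite measure on the line is determined by its Poisson integral up to a multiple of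
the imaginary part. -/
theorem MeasureTheory.Measure.ext_of_integral_cayleyPoissonKernel_eq {p q : Measure ℝ}
    [IsFiniteMeasure p] [IsFiniteMeasure q] (d : ℝ)
    (h : ∀ w ∈ upperHalf, ∫ t, cayleyPoissonKernel w t ∂p =
      (∫ t, cayleyPoissonKernel w t ∂q) + w.im * d) : p = q := by
  refine Measure.ext_of_integral_eq_on_compactlySupported fun g => ?_
  -- Chosen to cancel the factor `(1 + t ^ 2) * π` in the boundary limit.
  set f : ℝ → ℝ := fun t => g t * ((1 + t ^ 2)⁻¹ * Real.pi⁻¹) with hf_def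
  have hf : Continuous f := by
    refine g.continuous.mul
      (Continuous.mul (Continuous.inv₀ (by fun_prop) fun t => ?_) (by fun_prop))
    positivity
  have hfc : HasCompactSupport f := g.hasCompactSupport.mul_right
  have hfg : ∀ t, (1 + t ^ 2) * (f t * Real.pi) = g t := fun t => by
    have : 1 + t ^ 2 ≠ 0 := by positivity
    simp only [hf_def]
    field_simp [Real.pi_ne_zero]
  have hp := tendsto_integral_mul_integral_cayleyPoissonKernel hf hfc p
  have hq := tendsto_integral_mul_integral_cayleyPoissonKernel hf hfc q
  simp only [hfg] at hp hq
  have hd : Tendsto (fun y : ℝ => y * d * ∫ x, f x) (𝓝[>] 0) (𝓝 0) := by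
    refine tendsto_nhdsWithin_of_tendsto_nhds ?_
    have : Continuous fun y : ℝ => y * d * ∫ x, f x := by fun_prop
    simpa using this.tendsto 0
  have hq' := hq.add hd
  rw [add_zero] at hq'
  refine tendsto_nhds_unique hp (hq'.congr' ?_)
  filter_upwards [self_mem_nhdsWithin] with y hy
  have hfi : Integrable f := hf.integrable_of_hasCompactSupport hfc
  have hqi : Integrable fun x => f x * ∫ t, cayleyPoissonKernel ⟨x, y⟩ t ∂q := by
    have := (integrable_mul_cayleyPoissonKernel_prod hf hfc q hy).integral_prod_left
    simpa only [Function.uncurry, integral_const_mul] using this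
  have hx : ∀ x : ℝ, f x * ∫ t, cayleyPoissonKernel ⟨x, y⟩ t ∂p =
      f x * (∫ t, cayleyPoissonKernel ⟨x, y⟩ t ∂q) + y * d * f x := fun x => by
    rw [h ⟨x, y⟩ hy]
    ring
  simp only [hx]
  rw [integral_add hqi (hfi.const_mul _), integral_const_mul]

/-! ### Integrals against vector, complex and signed measures. -/

section
variable {X : Type*} {mX : MeasurableSpace X}
  {F : Type*} [NormedAddCommGroup F] [NormedSpace ℝ F]
  {F' : Type*} [NormedAddCommGroup F'] [NormedSpace ℝ F']

theorem MeasureTheory.VectorMeasure.variation_le_of_apply_eq {μ : VectorMeasure X F}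
    {ν : VectorMeasure X F'} (T : F →L[ℝ] F') (h : ∀ s, ν s = T (μ s)) :
    ν.variation ≤ (‖T‖₊ : ENNReal) • μ.variation := by
  refine VectorMeasure.variation_le_of_forall_enorm_le fun E _ => ?_
  rw [h, Measure.smul_apply, smul_eq_mul]
  exact (T.le_opENorm (μ E)).trans (mul_le_mul_right (μ.enorm_measure_le_variation E) _)

/-- Integration against a vector measure commutes with continuous linear maps of the values. -/
theorem MeasureTheory.VectorMeasure.integral_of_apply_eq [CompleteSpace F] [CompleteSpace F']
    {μ : VectorMeasure X F} {ν : VectorMeasure X F'} (T : F →L[ℝ] F') (h : ∀ s, ν s = T (μ s))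
    {f : X → ℝ} (hf : μ.Integrable f) :
    ν.integral f (ContinuousLinearMap.lsmul ℝ ℝ) =
      T (μ.integral f (ContinuousLinearMap.lsmul ℝ ℝ)) := by
  -- Viewing the `ν`-integral as an extension over `μ.variation` lets both sides be compared by
  -- induction on one space of integrable functions.
  have hdom : DominatedFinMeasAdditive μ.variation
      (cbmApplyMeasure ν (ContinuousLinearMap.lsmul ℝ ℝ)) ‖T‖ := by
    refine ⟨fun s t hs ht _ _ hd => cbmApplyMeasure_union ν _ hs ht hd, fun s hs hsf => ?_⟩
    refine (norm_cbmApplyMeasure_le ν (ContinuousLinearMap.lsmul ℝ ℝ) s).trans ?_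
    refine (mul_le_of_le_one_left (norm_nonneg _) ContinuousLinearMap.opNorm_lsmul_le).trans ?_
    rw [h]
    refine (T.le_opNorm _).trans ?_
    gcongr
    exact VectorMeasure.norm_measure_le_variation hsf.ne
  have hc : ν.integral f (ContinuousLinearMap.lsmul ℝ ℝ) = setToFun μ.variation _ hdom f :=
    (setToFun_congr_measure_of_integrable (‖T‖₊ : ENNReal) ENNReal.coe_ne_top
      (VectorMeasure.variation_le_of_apply_eq T h) hdom _ f hf).symm
  rw [hc]
  refine Integrable.induction (fun g => setToFun μ.variation _ hdom g =
      T (setToFun μ.variation _ (dominatedFinMeasAdditive_cbmApplyMeasure μ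
        (ContinuousLinearMap.lsmul ℝ ℝ)) g)) (fun c s hs hsf => ?_)
    (fun g₁ g₂ _ h₁ h₂ e₁ e₂ => ?_) ?_ (fun g₁ g₂ hg _ e => ?_) hf
  · rw [setToFun_indicator_const _ hs hsf.ne, setToFun_indicator_const _ hs hsf.ne,
      cbmApplyMeasure_apply, h]
    exact (T.map_smul c (μ s)).symm
  · rw [setToFun_add _ h₁ h₂, setToFun_add _ h₁ h₂, e₁, e₂]
    exact (T.map_add _ _).symm
  · exact isClosed_eq (continuous_setToFun _) (T.continuous.comp (continuous_setToFun _))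
  · rw [← setToFun_congr_ae _ hg, ← setToFun_congr_ae _ hg, e]

theorem MeasureTheory.ComplexMeasure.isFiniteMeasure_variation (c : ComplexMeasure X) :
    IsFiniteMeasure c.variation := by
  have hle : c.variation ≤ (ComplexMeasure.re c).variation + (ComplexMeasure.im c).variation := by
    refine VectorMeasure.variation_le_of_forall_enorm_le fun E _ => ?_
    have h : ‖c E‖ₑ ≤ ‖(c E).re‖ₑ + ‖(c E).im‖ₑ := by
      have := enorm_add_le ((c E).re : ℂ) ((c E).im * Complex.I : ℂ)
      rw [Complex.re_add_im, enorm_mul] at this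
      simpa [enorm_eq_nnnorm] using this
    refine h.trans (add_le_add ?_ ?_)
    · exact (ComplexMeasure.re c).enorm_measure_le_variation E
    · exact (ComplexMeasure.im c).enorm_measure_le_variation E
  have h1 : IsFiniteMeasure (ComplexMeasure.re c).variation := by
    rw [← SignedMeasure.totalVariation_eq_variation, SignedMeasure.totalVariation]
    infer_instance
  have h2 : IsFiniteMeasure (ComplexMeasure.im c).variation := by
    rw [← SignedMeasure.totalVariation_eq_variation, SignedMeasure.totalVariation]
    infer_instance
  exact isFiniteMeasure_of_le _ hle

theorem MeasureTheory.SignedMeasure.integral_eq_sub (s : SignedMeasure X) {f : X → ℝ}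
    (hp : Integrable f s.toJordanDecomposition.posPart)
    (hn : Integrable f s.toJordanDecomposition.negPart) :
    s.integral f (ContinuousLinearMap.lsmul ℝ ℝ) =
      ∫ x, f x ∂s.toJordanDecomposition.posPart - ∫ x, f x ∂s.toJordanDecomposition.negPart := by
  have hB : (ContinuousLinearMap.lsmul ℝ ℝ : ℝ →L[ℝ] ℝ →L[ℝ] ℝ) =
      (ContinuousLinearMap.lsmul ℝ ℝ).flip := by
    ext
    simp
  conv_lhs => rw [← s.toSignedMeasure_toJordanDecomposition, JordanDecomposition.toSignedMeasure]
  rw [VectorMeasure.integral_sub_vectorMeasure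
    (by simpa [VectorMeasure.Integrable] using hp) (by simpa [VectorMeasure.Integrable] using hn),
    hB, VectorMeasure.integral_toSignedMeasure, VectorMeasure.integral_toSignedMeasure]
end

/-! ### Uniqueness of the Clark measure. -/

theorem integrable_variation_cayleyPoissonKernel (c : ComplexMeasure ℝ) {w : ℂ}
    (hw : w ∈ upperHalf) : c.Integrable (cayleyPoissonKernel w) :=
  have := c.isFiniteMeasure_variation
  integrable_cayleyPoissonKernel _ hw

/-- The two Jordan parts have Poisson integrals differing by a multiple of `Im w`, so they coincide
and cancel. -/
theorem MeasureTheory.SignedMeasure.eq_zero_of_integral_cayleyPoissonKernel_eq (s : SignedMeasure ℝ)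
    (d : ℝ) (h : ∀ w ∈ upperHalf,
      s.integral (cayleyPoissonKernel w) (ContinuousLinearMap.lsmul ℝ ℝ) = w.im * d) : s = 0 := by
  have hpn : s.toJordanDecomposition.posPart = s.toJordanDecomposition.negPart := by
    refine Measure.ext_of_integral_cayleyPoissonKernel_eq d fun w hw => ?_
    have := h w hw
    rw [s.integral_eq_sub (integrable_cayleyPoissonKernel _ hw)
      (integrable_cayleyPoissonKernel _ hw)] at this
    linarith
  rw [← s.toSignedMeasure_toJordanDecomposition, JordanDecomposition.toSignedMeasure]
  simp [hpn]

theorem MeasureTheory.ComplexMeasure.ext_of_integral_cayleyPoissonKernel_eq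
    {μ ν : ComplexMeasure ℝ} (a b : ℂ)
    (h : ∀ w ∈ upperHalf,
      w.im * a + μ.integral (cayleyPoissonKernel w) (ContinuousLinearMap.lsmul ℝ ℝ) =
      w.im * b + ν.integral (cayleyPoissonKernel w) (ContinuousLinearMap.lsmul ℝ ℝ)) :
    μ = ν := by
  have hsub : ∀ w ∈ upperHalf,
      (μ - ν).integral (cayleyPoissonKernel w) (ContinuousLinearMap.lsmul ℝ ℝ) =
        w.im * (b - a) := fun w hw => by
    rw [VectorMeasure.integral_sub_vectorMeasure (integrable_variation_cayleyPoissonKernel μ hw)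
      (integrable_variation_cayleyPoissonKernel ν hw)]
    linear_combination h w hw
  have hre : ComplexMeasure.re (μ - ν) = 0 := by
    refine SignedMeasure.eq_zero_of_integral_cayleyPoissonKernel_eq _ (b - a).re fun w hw => ?_
    rw [VectorMeasure.integral_of_apply_eq (μ := μ - ν) Complex.reCLM (fun s => rfl)
      (integrable_variation_cayleyPoissonKernel _ hw), hsub w hw]
    simp
  have him : ComplexMeasure.im (μ - ν) = 0 := by
    refine SignedMeasure.eq_zero_of_integral_cayleyPoissonKernel_eq _ (b - a).im fun w hw => ?_
    rw [VectorMeasure.integral_of_apply_eq (μ := μ - ν) Complex.imCLM (fun s => rfl)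
      (integrable_variation_cayleyPoissonKernel _ hw), hsub w hw]
    simp
  refine sub_eq_zero.1 ?_
  ext s hs
  apply Complex.ext
  · exact congrArg (fun m : SignedMeasure ℝ => m s) hre
  · exact congrArg (fun m : SignedMeasure ℝ => m s) him

theorem IsClarkMeasure.unique {n : ℕ} {C : ℂ → Matrix (Fin n) (Fin n) ℂ}
    {μ ν : VectorMeasure ℝ (Matrix (Fin n) (Fin n) ℂ)} (hμ : IsClarkMeasure C μ)
    (hν : IsClarkMeasure C ν) : μ = ν := by
  obtain ⟨-, a, -, ha⟩ := hμ
  obtain ⟨-, b, -, hb⟩ := hν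
  ext s hs j k : 3
  have : measureEntry μ j k = measureEntry ν j k :=
    ComplexMeasure.ext_of_integral_cayleyPoissonKernel_eq (a j k) (b j k) fun w hw =>
      (ha w hw j k).symm.trans (hb w hw j k)
  exact congrArg (fun m : ComplexMeasure ℝ => m s) this

/-! ### Linearity of complex Radon-Nikodym derivatives. -/

section
variable {X : Type*} {mX : MeasurableSpace X} (m : Measure X) [SigmaFinite m]

theorem MeasureTheory.ComplexMeasure.rnDeriv_add (c d : ComplexMeasure X) :
    (c + d).rnDeriv m =ᵐ[m] c.rnDeriv m + d.rnDeriv m := by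
  have hre := SignedMeasure.rnDeriv_add (ComplexMeasure.re c) (ComplexMeasure.re d) m
  have him := SignedMeasure.rnDeriv_add (ComplexMeasure.im c) (ComplexMeasure.im d) m
  rw [← map_add] at hre him
  filter_upwards [hre, him] with x h₁ h₂
  exact Complex.ext h₁ h₂

theorem MeasureTheory.ComplexMeasure.re_smul (z : ℂ) (c : ComplexMeasure X) :
    ComplexMeasure.re (z • c) = z.re • ComplexMeasure.re c - z.im • ComplexMeasure.im c := by
  ext s hs
  exact Complex.mul_re z (c s)

theorem MeasureTheory.ComplexMeasure.im_smul (z : ℂ) (c : ComplexMeasure X) :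
    ComplexMeasure.im (z • c) = z.re • ComplexMeasure.im c + z.im • ComplexMeasure.re c := by
  ext s hs
  exact Complex.mul_im z (c s)

theorem MeasureTheory.ComplexMeasure.rnDeriv_smul (z : ℂ) (c : ComplexMeasure X) :
    (z • c).rnDeriv m =ᵐ[m] z • c.rnDeriv m := by
  have hre := SignedMeasure.rnDeriv_sub (z.re • ComplexMeasure.re c) (z.im • ComplexMeasure.im c) m
  have him := SignedMeasure.rnDeriv_add (z.re • ComplexMeasure.im c) (z.im • ComplexMeasure.re c) m
  rw [← ComplexMeasure.re_smul] at hre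
  rw [← ComplexMeasure.im_smul] at him
  filter_upwards [hre, him, SignedMeasure.rnDeriv_smul (ComplexMeasure.re c) m z.re,
    SignedMeasure.rnDeriv_smul (ComplexMeasure.im c) m z.re,
    SignedMeasure.rnDeriv_smul (ComplexMeasure.re c) m z.im,
    SignedMeasure.rnDeriv_smul (ComplexMeasure.im c) m z.im] with x h₁ h₂ h₃ h₄ h₅ h₆
  simp only [Pi.sub_apply, Pi.add_apply, h₃, h₄, h₅, h₆] at h₁ h₂
  refine Complex.ext (h₁.trans ?_) (h₂.trans ?_)
  · exact (Complex.mul_re z (c.rnDeriv m x)).symm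
  · exact (Complex.mul_im z (c.rnDeriv m x)).symm

theorem MeasureTheory.ComplexMeasure.rnDeriv_sum {ι : Type*} (t : Finset ι)
    (c : ι → ComplexMeasure X) :
    (∑ i ∈ t, c i).rnDeriv m =ᵐ[m] ∑ i ∈ t, (c i).rnDeriv m := by
  classical
  induction t using Finset.induction_on with
  | empty =>
    have := ComplexMeasure.rnDeriv_smul m 0 (0 : ComplexMeasure X)
    have h0 : (0 : ℂ) • (0 : ComplexMeasure X) = 0 := by
      ext1 s hs
      exact zero_mul (0 : ℂ)
    rwa [h0, zero_smul] at this
  | insert i t hi ih =>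
    rw [Finset.sum_insert hi, Finset.sum_insert hi]
    exact (ComplexMeasure.rnDeriv_add m _ _).trans ((EventuallyEq.refl _ _).add ih)
end

/-! ### Unitary conjugation of Clark measures. -/

theorem MeasureTheory.ComplexMeasure.integral_cayleyPoissonKernel_sum_smul {ι : Type*}
    (t : Finset ι) (z : ι → ℂ) (c : ι → ComplexMeasure ℝ) {w : ℂ} (hw : w ∈ upperHalf) :
    (∑ i ∈ t, z i • c i : ComplexMeasure ℝ).integral (cayleyPoissonKernel w)
        (ContinuousLinearMap.lsmul ℝ ℝ) =
      ∑ i ∈ t, z i * (c i).integral (cayleyPoissonKernel w) (ContinuousLinearMap.lsmul ℝ ℝ) := by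
  rw [VectorMeasure.integral_finsetSum_vectorMeasure fun i _ =>
    integrable_variation_cayleyPoissonKernel (z i • c i) hw]
  refine Finset.sum_congr rfl fun i _ => ?_
  exact VectorMeasure.integral_of_apply_eq (ContinuousLinearMap.mul ℝ ℂ (z i)) (fun s => rfl)
    (integrable_variation_cayleyPoissonKernel (c i) hw)

section
variable {n : ℕ}

/-- A single sum over pairs makes each conjugated entry a linear combination with constant
coefficients, the form in which integrals and derivatives are computed. -/
theorem Matrix.mul_mul_conjTranspose_apply (R A : Matrix (Fin n) (Fin n) ℂ) (j k : Fin n) :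
    (R * A * Rᴴ) j k = ∑ p : Fin n × Fin n, R j p.1 * star (R k p.2) * A p.1 p.2 := by
  rw [Fintype.sum_prod_type_right]
  simp only [Matrix.mul_apply, Matrix.conjTranspose_apply, Finset.sum_mul]
  exact Finset.sum_congr rfl fun b _ => Finset.sum_congr rfl fun a _ => by ring

/-- The conjugate `R μ R*` of a matrix-valued measure `μ` by a constant matrix `R`. -/
noncomputable def conjMeasure (R : Matrix (Fin n) (Fin n) ℂ)
    (μ : VectorMeasure ℝ (Matrix (Fin n) (Fin n) ℂ)) :
    VectorMeasure ℝ (Matrix (Fin n) (Fin n) ℂ) :=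
  μ.mapRange ((AddMonoidHom.mulRight Rᴴ).comp (AddMonoidHom.mulLeft R))
    ((continuous_const.matrix_mul continuous_id).matrix_mul continuous_const)

theorem conjMeasure_apply (R : Matrix (Fin n) (Fin n) ℂ)
    (μ : VectorMeasure ℝ (Matrix (Fin n) (Fin n) ℂ)) (s : Set ℝ) :
    conjMeasure R μ s = R * μ s * Rᴴ := rfl

theorem measureEntry_conjMeasure (R : Matrix (Fin n) (Fin n) ℂ)
    (μ : VectorMeasure ℝ (Matrix (Fin n) (Fin n) ℂ)) (j k : Fin n) :
    measureEntry (conjMeasure R μ) j k =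
      ∑ p : Fin n × Fin n, (R j p.1 * star (R k p.2)) • measureEntry μ p.1 p.2 := by
  ext1 s hs
  rw [← FunLike.coeAddMonoidHom_apply (∑ p : Fin n × Fin n, _), map_sum, Finset.sum_apply]
  exact Matrix.mul_mul_conjTranspose_apply R (μ s) j k

theorem lebesgueWeight_conjMeasure (R : Matrix (Fin n) (Fin n) ℂ)
    (μ : VectorMeasure ℝ (Matrix (Fin n) (Fin n) ℂ)) :
    ∀ᵐ s : ℝ, lebesgueWeight (conjMeasure R μ) s = R * lebesgueWeight μ s * Rᴴ := by
  have h : ∀ j k, ∀ᵐ s : ℝ, lebesgueWeight (conjMeasure R μ) s j k =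
      (R * lebesgueWeight μ s * Rᴴ) j k := fun j k => by
    have hsum := ComplexMeasure.rnDeriv_sum volume Finset.univ
      fun p : Fin n × Fin n => (R j p.1 * star (R k p.2)) • measureEntry μ p.1 p.2
    rw [← measureEntry_conjMeasure] at hsum
    have hsmul : ∀ᵐ s : ℝ, ∀ p : Fin n × Fin n,
        ((R j p.1 * star (R k p.2)) • measureEntry μ p.1 p.2 : ComplexMeasure ℝ).rnDeriv volume s =
          (R j p.1 * star (R k p.2)) * (measureEntry μ p.1 p.2).rnDeriv volume s :=
      ae_all_iff.2 fun p => ComplexMeasure.rnDeriv_smul volume _ _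
    filter_upwards [hsum, hsmul] with s h₁ h₂
    rw [Matrix.mul_mul_conjTranspose_apply]
    refine h₁.trans ?_
    rw [Finset.sum_apply]
    exact Finset.sum_congr rfl fun p _ => h₂ p
  filter_upwards [ae_all_iff.2 fun j => ae_all_iff.2 (h j)] with s hs
  ext j k
  exact hs j k

theorem herglotz_of_eq_conj {C D : ℂ → Matrix (Fin n) (Fin n) ℂ} {R : Matrix (Fin n) (Fin n) ℂ}
    (hR : R ∈ Matrix.unitaryGroup (Fin n) ℂ) {w : ℂ} (h : D w = R * C w * Rᴴ) :
    herglotz D w = R * herglotz C w * Rᴴ := by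
  have h1 : R * Rᴴ = 1 := (Matrix.mem_unitaryGroup_iff).1 hR
  have h2 : Rᴴ * R = 1 := (Matrix.mem_unitaryGroup_iff').1 hR
  have hinv : R⁻¹ = Rᴴ := Matrix.inv_eq_right_inv h1
  have hinv' : Rᴴ⁻¹ = R := Matrix.inv_eq_right_inv h2
  have hs : 1 - D w = R * (1 - C w) * Rᴴ := by rw [h, mul_sub, sub_mul, mul_one, h1]
  have ha : 1 + D w = R * (1 + C w) * Rᴴ := by rw [h, mul_add, add_mul, mul_one, h1]
  rw [herglotz, herglotz, hs, ha, Matrix.mul_inv_rev, Matrix.mul_inv_rev, hinv, hinv']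
  calc R * ((1 - C w)⁻¹ * Rᴴ) * (R * (1 + C w) * Rᴴ)
      = R * (1 - C w)⁻¹ * (Rᴴ * R) * (1 + C w) * Rᴴ := by simp only [mul_assoc]
    _ = R * ((1 - C w)⁻¹ * (1 + C w)) * Rᴴ := by rw [h2]; simp only [mul_assoc, one_mul]

theorem hermitianPart_conj (R A : Matrix (Fin n) (Fin n) ℂ) :
    hermitianPart (R * A * Rᴴ) = R * hermitianPart A * Rᴴ := by
  simp only [hermitianPart, Matrix.conjTranspose_mul, Matrix.conjTranspose_conjTranspose,
    Matrix.mul_smul, Matrix.smul_mul, mul_add, add_mul, mul_assoc]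

theorem IsClarkMeasure.conj {C D : ℂ → Matrix (Fin n) (Fin n) ℂ} {R : Matrix (Fin n) (Fin n) ℂ}
    (hR : R ∈ Matrix.unitaryGroup (Fin n) ℂ) (h : ∀ w ∈ upperHalf, D w = R * C w * Rᴴ)
    {μ : VectorMeasure ℝ (Matrix (Fin n) (Fin n) ℂ)} (hμ : IsClarkMeasure C μ) :
    IsClarkMeasure D (conjMeasure R μ) := by
  obtain ⟨hpos, c, hc, hrep⟩ := hμ
  refine ⟨fun E hE => (hpos E hE).mul_mul_conjTranspose_same R, R * c * Rᴴ,
    hc.mul_mul_conjTranspose_same R, fun w hw j k => ?_⟩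
  rw [herglotz_of_eq_conj hR (h w hw), hermitianPart_conj, measureEntry_conjMeasure,
    ComplexMeasure.integral_cayleyPoissonKernel_sum_smul _ _ _ hw,
    Matrix.mul_mul_conjTranspose_apply, Matrix.mul_mul_conjTranspose_apply, Finset.mul_sum,
    ← Finset.sum_add_distrib]
  refine Finset.sum_congr rfl fun p _ => ?_
  rw [hrep w hw]
  ring

theorem IsClarkMeasure.clarkMeasure_eq {C : ℂ → Matrix (Fin n) (Fin n) ℂ}
    {μ : VectorMeasure ℝ (Matrix (Fin n) (Fin n) ℂ)} (hμ : IsClarkMeasure C μ) :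
    clarkMeasure C = μ := by
  have h : ∃ μ, IsClarkMeasure C μ := ⟨μ, hμ⟩
  rw [clarkMeasure, dif_pos h]
  exact h.choose_spec.unique hμ

theorem clarkMeasure_conj {C D : ℂ → Matrix (Fin n) (Fin n) ℂ} {R : Matrix (Fin n) (Fin n) ℂ}
    (hR : R ∈ Matrix.unitaryGroup (Fin n) ℂ) (h : ∀ w ∈ upperHalf, D w = R * C w * Rᴴ) :
    clarkMeasure D = conjMeasure R (clarkMeasure C) := by
  by_cases hC : ∃ μ, IsClarkMeasure C μ
  · obtain ⟨μ, hμ⟩ := hC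
    rw [hμ.clarkMeasure_eq, (hμ.conj hR h).clarkMeasure_eq]
  -- Conjugating back by `Rᴴ` shows that `D` has no Clark measure either, so both sides are the
  -- default `0`.
  · have h2 : Rᴴ * R = 1 := (Matrix.mem_unitaryGroup_iff').1 hR
    have hR' : Rᴴ ∈ Matrix.unitaryGroup (Fin n) ℂ := Unitary.star_mem hR
    have hD : ¬ ∃ μ, IsClarkMeasure D μ := fun ⟨μ, hμ⟩ => by
      refine hC ⟨conjMeasure Rᴴ μ, hμ.conj hR' fun w hw => ?_⟩
      rw [h w hw, Matrix.conjTranspose_conjTranspose]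
      calc C w = (Rᴴ * R) * C w * (Rᴴ * R) := by rw [h2, one_mul, mul_one]
        _ = Rᴴ * (R * C w * Rᴴ) * R := by simp only [mul_assoc]
    rw [clarkMeasure, clarkMeasure, dif_neg hC, dif_neg hD]
    ext1 s hs
    simp [conjMeasure_apply]

end

theorem mainTheorem5 (n : ℕ) (B₁ B₂ : ℂ → Matrix (Fin n) (Fin n) ℂ)
    (hB₁ : B₁ ∈ schurClass n upperHalf) (hB₂ : B₂ ∈ schurClass n upperHalf)
    (R Q α : Matrix (Fin n) (Fin n) ℂ)
    (hR : R ∈ Matrix.unitaryGroup (Fin n) ℂ) (hQ : Q ∈ Matrix.unitaryGroup (Fin n) ℂ)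
    (hα : α ∈ Matrix.unitaryGroup (Fin n) ℂ)
    (hB : ∀ w ∈ upperHalf, B₁ w = R * B₂ w * Q)
    (hinv : ∀ w ∈ upperHalf, IsUnit (1 - B₁ w * αᴴ)) :
    ∀ᵐ s : ℝ, lebesgueWeight (clarkMeasure fun w => B₁ w * αᴴ) s =
      R * lebesgueWeight (clarkMeasure fun w => B₂ w * (Q * αᴴ * R)) s * Rᴴ := by
  have h1 : R * Rᴴ = 1 := (Matrix.mem_unitaryGroup_iff).1 hR
  rw [clarkMeasure_conj (C := fun w => B₂ w * (Q * αᴴ * R)) hR fun w hw => ?_]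
  · exact lebesgueWeight_conjMeasure R _
  -- Inserting `R * Rᴴ` on the right exposes the conjugation by `R`.
  · calc B₁ w * αᴴ = R * B₂ w * Q * αᴴ * (R * Rᴴ) := by rw [hB w hw, h1, mul_one]
      _ = R * (B₂ w * (Q * αᴴ * R)) * Rᴴ := by simp only [mul_assoc]
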